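/- Let $\mathbb X$, $\mathbb Y$, $\mathbb A$ (state, observation and action spaces) be Borel subsets of Polish spaces, let $P(dx'|x,a)$ be a transition probability from $\mathbb X\times\mathbb A$ to $\mathbb X$, and let $Q(dy|a,x)$ be a transition probability from $\mathbb A\times\mathbb X$ to $\mathbb Y$. Let $\mathcal P(\mathbb X)$ be the space of Borel probability measures on $\mathbb X$ with the topology of weak convergence. A transition probability $\kappa(\cdot|s)$ is called weakly (setwise, in total variation) continuous if $s_n\to s$ implies that $\kappa(\cdot|s_n)\to\kappa(\cdot|s)$ weakly (respectively: $\kappa(C|s_n)\to\kappa(C|s)$ for every measurable set $C$; $2\sup_C\{\kappa(C|s_n)-\kappa(C|s)\}\to0$, the supremum being over measurable sets $C$). For $z\in\mathcal P(\mathbb X)$, $a\in\mathbb A$ and Borel sets $B\subseteq\mathbb X$, $C\subseteq\mathbb Y$, let $$R(B\times C|z,a)=\int_{\mathbb X}\int_B Q(C|a,x')\,P(dx'|x,a)\,z(dx),\qquad R'(C|z,a)=R(\mathbb X\times C|z,a).$$ A transition probability $H$ from $\mathcal P(\mathbb X)\times\mathbb A\times\mathbb Y$ to $\mathbb X$ is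 called a filtering kernel if, for all $z,a,B,C$, $$R(B\times C|z,a)=\int_C H(B|z,a,y)\,R'(dy|z,a).$$ Writing $H(z,a,y)=H(\cdot|z,a,y)\in\mathcal P(\mathbb X)$, the belief transition probability $q$ from $\mathcal P(\mathbb X)\times\mathbb A$ to $\mathcal P(\mathbb X)$ is $$q(D|z,a)=\int_{\mathbb Y}\mathbf 1_D[H(z,a,y)]\,R'(dy|z,a),\qquad D\in\mathcal B(\mathcal P(\mathbb X)),$$ where $H$ is any filtering kernel ($q$ does not depend on this choice). Theorem. Suppose that $P$ is weakly continuous and that $Q$ is continuous in total variation. Then: (1) the transition probability $R'(dy|z,a)$ from $\mathcal P(\mathbb X)\times\mathbb A$ to $\mathbb Y$ is setwise continuous; (2) (Assumption H) there exists a filtering kernel $H$ such that, whenever $z^n\to z$ weakly in $\mathcal P(\mathbb X)$ and $a^n\to a$ in $\mathbb A$, there is a subsequence $(z^{n_k},a^{n_k})$ for which $H(z^{n_k},a^{n_k},y)$ converges weakly to $H(z,a,y)$ as $k\to\infty$ for $R'(\cdot|z,a)$-almost every $y\in\mathbb Y$; (3) the transition probability $q(\cdot|z,a)$ from $\mathcal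 P(\mathbb X)\times\mathbb A$ to $\mathcal P(\mathbb X)$ is weakly continuous (for every choice of the filtering kernel $H$ that defines it). -/

import Mathlib

open MeasureTheory ProbabilityTheory Filter Topology TopologicalSpace
open scoped ENNReal NNReal BoundedContinuousFunction

namespace POMDP

/-! ### Borel structure of the space of probability measures

`ProbabilityMeasure X` carries the topology of weak convergence and the sigma-algebra generated by
the evaluations `μ ↦ μ B`.  For separable metrizable `X` this sigma-algebra is the Borel one. -/

lemma isInducing_probabilityMeasure_map {X K : Type*}
    [TopologicalSpace X] [MetrizableSpace X] [SecondCountableTopology X]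
    [MeasurableSpace X] [BorelSpace X]
    [TopologicalSpace K] [MetrizableSpace K] [SecondCountableTopology K]
    [MeasurableSpace K] [BorelSpace K] {e : X → K} (he : IsEmbedding e) :
    IsInducing (fun μ : ProbabilityMeasure X =>
      μ.map (f := e) he.continuous.measurable.aemeasurable) := by
  refine isInducing_iff_nhds.2 fun μ => le_antisymm ?_ ?_
  · exact ((ProbabilityMeasure.continuous_map he.continuous).tendsto μ).le_comap
  · refine tendsto_id'.1 (tendsto_of_seq_tendsto fun u hu => ?_)
    have hu' := tendsto_comap_iff.1 hu
    refine tendsto_of_forall_isOpen_le_liminf_nat' fun G hG => ?_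
    obtain ⟨G', hG', rfl⟩ := he.isInducing.isOpen_iff.1 hG
    have h := ProbabilityMeasure.le_liminf_measure_open_of_tendsto hu' hG'
    simpa [ProbabilityMeasure.toMeasure_map, Measure.map_apply he.continuous.measurable
      hG'.measurableSet] using h

instance instSecondCountableProbabilityMeasure {X : Type*} [TopologicalSpace X]
    [MetrizableSpace X] [SecondCountableTopology X] [MeasurableSpace X] [BorelSpace X] :
    SecondCountableTopology (ProbabilityMeasure X) := by
  let _ : MetricSpace X := metrizableSpaceMetric X
  obtain ⟨e, he⟩ := Metric.PiNatEmbed.exists_embedding_to_hilbert_cube (X := X)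
  let _ : MetricSpace (ProbabilityMeasure (ℕ → unitInterval)) := metrizableSpaceMetric _
  have : SecondCountableTopology (ProbabilityMeasure (ℕ → unitInterval)) := inferInstance
  exact (isInducing_probabilityMeasure_map he).secondCountableTopology

instance instBorelSpaceProbabilityMeasure {X : Type*} [TopologicalSpace X]
    [MetrizableSpace X] [SecondCountableTopology X] [MeasurableSpace X] [BorelSpace X] :
    BorelSpace (ProbabilityMeasure X) := by
  constructor
  apply le_antisymm
  · have hid : @Measurable (ProbabilityMeasure X) (Measure X) (borel _) _ (fun μ => (μ : Measure X)) := by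
      let _ : MeasurableSpace (ProbabilityMeasure X) := borel _
      have : BorelSpace (ProbabilityMeasure X) := ⟨rfl⟩
      refine Measurable.measure_of_isPiSystem_of_isProbabilityMeasure
        (S := {s : Set X | IsClosed s}) (BorelSpace.measurable_eq.trans borel_eq_generateFrom_isClosed)
        isPiSystem_isClosed fun F hF => ?_
      refine measurable_of_tendsto_metrizable
        (f := fun n (μ : ProbabilityMeasure X) => ∫⁻ x, (IsClosed.apprSeq hF n x : ℝ≥0∞) ∂(μ : Measure X))
        (fun n => ?_) (tendsto_pi_nhds.2 fun μ => HasOuterApproxClosed.tendsto_lintegral_apprSeq hF _)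
      exact (ProbabilityMeasure.continuous_lintegral_boundedContinuousFunction _).measurable
    exact measurable_iff_comap_le.1 hid
  · let T : (X →ᵇ ℝ≥0) → TopologicalSpace (ProbabilityMeasure X) := fun f =>
      induced (fun μ => μ.toFiniteMeasure.testAgainstNN f) inferInstance
    have h : (inferInstance : TopologicalSpace (ProbabilityMeasure X)) = ⨅ f, T f := by
      refine le_antisymm (le_iInf fun f => ?_) (le_of_nhds_le_nhds fun μ => ?_)
      · exact continuous_iff_le_induced.1 (ProbabilityMeasure.continuous_testAgainstNN_eval f)
      · refine tendsto_id'.1 ((ProbabilityMeasure.tendsto_nhds_iff_toFiniteMeasure_tendsto_nhds _).2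
          (FiniteMeasure.tendsto_iff_forall_testAgainstNN_tendsto.2 fun f => ?_))
        have hf : @Tendsto _ _ (fun ν : ProbabilityMeasure X => ν.toFiniteMeasure.testAgainstNN f)
            (@nhds _ (T f) μ) (𝓝 (μ.toFiniteMeasure.testAgainstNN f)) :=
          (@Continuous.tendsto _ _ (T f) _ _ (continuous_iff_le_induced.2 le_rfl) μ)
        exact hf.mono_left (nhds_mono (iInf_le T f))
    have h := h.trans (generateFrom_iUnion_isOpen T).symm
    rw [borel_eq_generateFrom_of_subbasis h]
    refine MeasurableSpace.generateFrom_le fun s hs => ?_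
    obtain ⟨f, t, ht, rfl⟩ := Set.mem_iUnion.1 hs
    have : Measurable (fun μ : ProbabilityMeasure X => μ.toFiniteMeasure.testAgainstNN f) := by
      refine ENNReal.measurable_toNNReal.comp ?_
      exact (Measure.measurable_lintegral (by fun_prop)).comp measurable_subtype_coe
    exact this ht.measurableSet

/-! ### Continuity of transition probabilities

A transition probability from `S` to `T` is a Markov kernel `κ : Kernel S T`. -/

/-- The value of a transition probability at a point, as a probability measure. -/
def law {S T : Type*} [MeasurableSpace S] [MeasurableSpace T] (κ : Kernel S T) [IsMarkovKernel κ]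
    (s : S) : ProbabilityMeasure T :=
  ⟨κ s, inferInstance⟩

lemma measurable_law {S T : Type*} [MeasurableSpace S] [MeasurableSpace T] (κ : Kernel S T)
    [IsMarkovKernel κ] : Measurable (law κ) :=
  κ.measurable.subtype_mk

/-- `κ` is weakly continuous: `κ(·|sₙ) → κ(·|s)` weakly whenever `sₙ → s`. -/
def WeaklyContinuous {S T : Type*} [TopologicalSpace S] [MeasurableSpace S] [TopologicalSpace T]
    [MeasurableSpace T] [OpensMeasurableSpace T] (κ : Kernel S T) [IsMarkovKernel κ] : Prop :=
  ∀ (u : ℕ → S) (s : S), Tendsto u atTop (𝓝 s) →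
    Tendsto (fun n => law κ (u n)) atTop (𝓝 (law κ s))

/-- `κ` is setwise continuous: `κ(C|sₙ) → κ(C|s)` for every measurable `C` whenever `sₙ → s`. -/
def SetwiseContinuous {S T : Type*} [TopologicalSpace S] [MeasurableSpace S] [MeasurableSpace T]
    (κ : Kernel S T) : Prop :=
  ∀ (u : ℕ → S) (s : S), Tendsto u atTop (𝓝 s) →
    ∀ C : Set T, MeasurableSet C → Tendsto (fun n => κ (u n) C) atTop (𝓝 (κ s C))

/-- Total variation distance `2 sup {μ(C) - ν(C) : C measurable}` of two probability measures. -/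
noncomputable def tvDist {T : Type*} [MeasurableSpace T] (μ ν : ProbabilityMeasure T) : ℝ :=
  2 * ⨆ C : {C : Set T // MeasurableSet C},
    ((μ : Measure T).real C.1 - (ν : Measure T).real C.1)

/-- `κ` is continuous in total variation: `‖κ(·|sₙ) - κ(·|s)‖ → 0` whenever `sₙ → s`. -/
def TVContinuous {S T : Type*} [TopologicalSpace S] [MeasurableSpace S] [MeasurableSpace T]
    (κ : Kernel S T) [IsMarkovKernel κ] : Prop :=
  ∀ (u : ℕ → S) (s : S), Tendsto u atTop (𝓝 s) →
    Tendsto (fun n => tvDist (law κ (u n)) (law κ s)) atTop (𝓝 0)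

/-! ### The kernels of the completely observable model -/

/-- The kernel `(z, a) ↦ z` from `𝓟(X) × A` to `X`. -/
def priorKernel (X A : Type*) [MeasurableSpace X] [MeasurableSpace A] :
    Kernel (ProbabilityMeasure X × A) X where
  toFun p := (p.1 : Measure X)
  measurable' := measurable_subtype_coe.comp measurable_fst

instance instIsMarkovKernelPriorKernel (X A : Type*) [MeasurableSpace X] [MeasurableSpace A] :
    IsMarkovKernel (priorKernel X A) :=
  ⟨fun p => inferInstanceAs (IsProbabilityMeasure (p.1 : Measure X))⟩

/-- The law of the next state: `(z, a) ↦ ∫ P(·|x,a) z(dx)`. -/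
noncomputable def nextStateKernel {X A : Type*} [MeasurableSpace X] [MeasurableSpace A]
    (P : Kernel (X × A) X) : Kernel (ProbabilityMeasure X × A) X :=
  (priorKernel X A ⊗ₖ P.comap (fun r : (ProbabilityMeasure X × A) × X => (r.2, r.1.2))
    (by fun_prop)).snd

instance instIsMarkovKernelNextStateKernel {X A : Type*} [MeasurableSpace X] [MeasurableSpace A]
    (P : Kernel (X × A) X) [IsMarkovKernel P] : IsMarkovKernel (nextStateKernel P) := by
  unfold nextStateKernel; infer_instance

/-- The joint law `R(·|z,a)` of the next state and the next observation; see
`jointKernel_apply_prod` for the defining formula. -/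
noncomputable def jointKernel {X Y A : Type*} [MeasurableSpace X] [MeasurableSpace Y]
    [MeasurableSpace A] (P : Kernel (X × A) X) (Q : Kernel (A × X) Y) :
    Kernel (ProbabilityMeasure X × A) (X × Y) :=
  nextStateKernel P ⊗ₖ Q.comap (fun r : (ProbabilityMeasure X × A) × X => (r.1.2, r.2))
    (by fun_prop)

instance instIsMarkovKernelJointKernel {X Y A : Type*} [MeasurableSpace X] [MeasurableSpace Y]
    [MeasurableSpace A] (P : Kernel (X × A) X) [IsMarkovKernel P] (Q : Kernel (A × X) Y)
    [IsMarkovKernel Q] : IsMarkovKernel (jointKernel P Q) := by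
  unfold jointKernel; infer_instance

/-- The law `R'(·|z,a)` of the next observation; see `obsKernel_apply`. -/
noncomputable def obsKernel {X Y A : Type*} [MeasurableSpace X] [MeasurableSpace Y]
    [MeasurableSpace A] (P : Kernel (X × A) X) (Q : Kernel (A × X) Y) :
    Kernel (ProbabilityMeasure X × A) Y :=
  (jointKernel P Q).snd

instance instIsMarkovKernelObsKernel {X Y A : Type*} [MeasurableSpace X] [MeasurableSpace Y]
    [MeasurableSpace A] (P : Kernel (X × A) X) [IsMarkovKernel P] (Q : Kernel (A × X) Y)
    [IsMarkovKernel Q] : IsMarkovKernel (obsKernel P Q) := by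
  unfold obsKernel; infer_instance

lemma lintegral_nextStateKernel {X A : Type*} [MeasurableSpace X] [MeasurableSpace A]
    (P : Kernel (X × A) X) [IsMarkovKernel P] (z : ProbabilityMeasure X) (a : A)
    {f : X → ℝ≥0∞} (hf : Measurable f) :
    ∫⁻ x', f x' ∂(nextStateKernel P (z, a)) =
      ∫⁻ x, ∫⁻ x', f x' ∂(P (x, a)) ∂(z : Measure X) := by
  rw [nextStateKernel, Kernel.lintegral_snd _ _ hf,
    Kernel.lintegral_compProd _ _ _ (f := fun r : X × X => f r.2) (by fun_prop)]
  rfl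

/-- `R(B × C|z,a) = ∫_X ∫_B Q(C|a,x') P(dx'|x,a) z(dx)`. -/
lemma jointKernel_apply_prod {X Y A : Type*} [MeasurableSpace X] [MeasurableSpace Y]
    [MeasurableSpace A] (P : Kernel (X × A) X) [IsMarkovKernel P] (Q : Kernel (A × X) Y)
    [IsMarkovKernel Q] (z : ProbabilityMeasure X) (a : A) {B : Set X} (hB : MeasurableSet B)
    {C : Set Y} (hC : MeasurableSet C) :
    jointKernel P Q (z, a) (B ×ˢ C) =
      ∫⁻ x, ∫⁻ x' in B, Q (a, x') C ∂(P (x, a)) ∂(z : Measure X) := by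
  have hm : Measurable fun x' => Q (a, x') C :=
    (Q.measurable_coe hC).comp (measurable_const.prodMk measurable_id)
  rw [jointKernel, Kernel.compProd_apply_prod hB hC, ← lintegral_indicator hB]
  simp only [Kernel.comap_apply]
  rw [lintegral_nextStateKernel P z a (hm.indicator hB)]
  simp only [lintegral_indicator hB]

/-- `R'(C|z,a) = ∫_X ∫_X Q(C|a,x') P(dx'|x,a) z(dx)`. -/
lemma obsKernel_apply {X Y A : Type*} [MeasurableSpace X] [MeasurableSpace Y]
    [MeasurableSpace A] (P : Kernel (X × A) X) [IsMarkovKernel P] (Q : Kernel (A × X) Y)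
    [IsMarkovKernel Q] (z : ProbabilityMeasure X) (a : A) {C : Set Y} (hC : MeasurableSet C) :
    obsKernel P Q (z, a) C = ∫⁻ x, ∫⁻ x', Q (a, x') C ∂(P (x, a)) ∂(z : Measure X) := by
  have h := jointKernel_apply_prod P Q z a MeasurableSet.univ hC
  simp only [Measure.restrict_univ] at h
  rw [obsKernel, Kernel.snd_apply' _ _ hC, ← h, Set.univ_prod]

/-- `H` is a filtering kernel: `R(B × C|z,a) = ∫_C H(B|z,a,y) R'(dy|z,a)`. -/
def IsFilteringKernel {X Y A : Type*} [MeasurableSpace X] [MeasurableSpace Y]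
    [MeasurableSpace A] (P : Kernel (X × A) X) (Q : Kernel (A × X) Y)
    (H : Kernel (ProbabilityMeasure X × A × Y) X) : Prop :=
  ∀ (z : ProbabilityMeasure X) (a : A) (B : Set X) (C : Set Y), MeasurableSet B →
    MeasurableSet C →
      jointKernel P Q (z, a) (B ×ˢ C) = ∫⁻ y in C, H (z, a, y) B ∂(obsKernel P Q (z, a))

/-- Assumption H: some filtering kernel `H` is such that, whenever `zₙ → z` weakly and `aₙ → a`,
along a subsequence `H(zₙ, aₙ, y) → H(z, a, y)` weakly for `R'(·|z,a)`-almost every `y`. -/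
def AssumptionH {X Y A : Type*} [TopologicalSpace X] [MeasurableSpace X] [OpensMeasurableSpace X]
    [MeasurableSpace Y] [TopologicalSpace A] [MeasurableSpace A]
    (P : Kernel (X × A) X) (Q : Kernel (A × X) Y) : Prop :=
  ∃ (H : Kernel (ProbabilityMeasure X × A × Y) X) (_ : IsMarkovKernel H),
    IsFilteringKernel P Q H ∧
    ∀ (zs : ℕ → ProbabilityMeasure X) (z : ProbabilityMeasure X) (as : ℕ → A) (a : A),
      Tendsto zs atTop (𝓝 z) → Tendsto as atTop (𝓝 a) →
        ∃ φ : ℕ → ℕ, StrictMono φ ∧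
          ∀ᵐ y ∂(obsKernel P Q (z, a)),
            Tendsto (fun k => law H (zs (φ k), as (φ k), y)) atTop (𝓝 (law H (z, a, y)))

/-- The transition probability `q` on beliefs determined by the filtering kernel `H`: the law of
`H(z, a, y)` when `y` has law `R'(·|z,a)`; see `beliefKernel_apply`. -/
noncomputable def beliefKernel {X Y A : Type*} [MeasurableSpace X] [MeasurableSpace Y]
    [MeasurableSpace A] (P : Kernel (X × A) X) (Q : Kernel (A × X) Y)
    (H : Kernel (ProbabilityMeasure X × A × Y) X) [IsMarkovKernel H] :
    Kernel (ProbabilityMeasure X × A) (ProbabilityMeasure X) :=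
  (Kernel.id ×ₖ obsKernel P Q).map
    (fun r : (ProbabilityMeasure X × A) × Y => law H (r.1.1, r.1.2, r.2))

lemma measurable_law_filter {X Y A : Type*} [MeasurableSpace X] [MeasurableSpace Y]
    [MeasurableSpace A] (H : Kernel (ProbabilityMeasure X × A × Y) X) [IsMarkovKernel H] :
    Measurable (fun r : (ProbabilityMeasure X × A) × Y => law H (r.1.1, r.1.2, r.2)) :=
  (measurable_law H).comp (by fun_prop)

instance instIsMarkovKernelBeliefKernel {X Y A : Type*} [MeasurableSpace X] [MeasurableSpace Y]
    [MeasurableSpace A] (P : Kernel (X × A) X) [IsMarkovKernel P] (Q : Kernel (A × X) Y)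
    [IsMarkovKernel Q] (H : Kernel (ProbabilityMeasure X × A × Y) X) [IsMarkovKernel H] :
    IsMarkovKernel (beliefKernel P Q H) :=
  Kernel.IsMarkovKernel.map _ (measurable_law_filter H)

/-- `q(D|z,a) = ∫_Y 1_D[H(z,a,y)] R'(dy|z,a)`. -/
lemma beliefKernel_apply {X Y A : Type*} [MeasurableSpace X] [MeasurableSpace Y]
    [MeasurableSpace A] (P : Kernel (X × A) X) [IsMarkovKernel P] (Q : Kernel (A × X) Y)
    [IsMarkovKernel Q] (H : Kernel (ProbabilityMeasure X × A × Y) X) [IsMarkovKernel H]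
    (z : ProbabilityMeasure X) (a : A) {D : Set (ProbabilityMeasure X)} (hD : MeasurableSet D) :
    beliefKernel P Q H (z, a) D =
      ∫⁻ y, D.indicator (fun _ => 1) (law H (z, a, y)) ∂(obsKernel P Q (z, a)) := by
  have hm := measurable_law_filter H
  rw [beliefKernel, Kernel.map_apply' _ hm _ hD, Kernel.id_prod_apply' _ _ (hm hD),
    ← lintegral_indicator_one (measurable_prodMk_left (hm hD))]
  rfl

end POMDP

namespace POMDP

/-! ### Weak convergence is uniform over equicontinuous bounded families -/

/-! Everything rests on convergence that is uniform over observation sets `C`. For bounded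
continuous `f`, the functions `(a, x') ↦ f x' * Q(C|a,x')`, indexed by measurable `C`, are uniformly
bounded and, since `Q` is continuous in total variation, equicontinuous. Weak convergence of
measures is uniform over such families (`eventually_forall_abs_integral_sub_le`), and the law of the
next state depends weakly continuously on `(z, a)`. So `∫ f(x') Q(C|a,x')` against that law
converges uniformly in `C` (`eventually_forall_abs_integral_mul_sub_le`). The case `f = 1` makes
`R'` continuous in total variation, hence setwise.

For a filtering kernel `H` the same integral equals `∫_C ∫ f dH(z,a,y) R'(dy|z,a)`. Uniformity in
`C` then gives `L¹(R'(·|z,a))` convergence of `y ↦ ∫ f dH(zₙ,aₙ,y)`. Applied to countably many `f`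
that determine weak convergence, a diagonal argument yields one subsequence along which the filters
converge weakly for almost every `y`. This holds for every filtering kernel, and disintegration
supplies one. Weak continuity of `q` follows by dominated convergence along subsequences, the change
of `R'` being controlled in total variation. -/

lemma integral_le_add_of_levyProkhorovEDist_lt {Ω : Type*} [MeasurableSpace Ω]
    [PseudoMetricSpace Ω] [OpensMeasurableSpace Ω] (μ ν : Measure Ω) [IsProbabilityMeasure μ]
    [IsProbabilityMeasure ν] {ε : ℝ} (hε : 0 < ε)
    (h : levyProkhorovEDist μ ν < ENNReal.ofReal ε) (f : Ω →ᵇ ℝ) (hf : ∀ x, 0 ≤ f x)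
    (hlip : ∀ x y, |f x - f y| ≤ dist x y) :
    ∫ x, f x ∂μ ≤ ∫ x, f x ∂ν + ε * (1 + ‖f‖) := by
  have h1 := BoundedContinuousFunction.integral_le_of_levyProkhorovEDist_lt μ ν hε h f
    (Eventually.of_forall hf)
  have hint : Integrable (fun x => f x + ε) ν := (f.integrable ν).add (integrable_const ε)
  have h2 : ∫ x, (f x + ε) ∂ν = ∫ t in Set.Ioc 0 (‖f‖ + ε), ν.real {a | t ≤ f a + ε} :=
    hint.integral_eq_integral_Ioc_meas_le (Eventually.of_forall fun x => by
      have := hf x; simp only [Pi.zero_apply]; positivity)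
      (Eventually.of_forall fun x => by
        have := (le_abs_self _).trans (f.norm_coe_le_norm x); simpa using this)
  have hanti : Antitone fun t : ℝ => ν.real {a | t ≤ f a + ε} := fun s t hst =>
    measureReal_mono fun a (ha : t ≤ f a + ε) => hst.trans ha
  have hbd : ∀ (s : Set ℝ), volume s ≠ ∞ →
      IntegrableOn (fun t : ℝ => ν.real {a | t ≤ f a + ε}) s := fun s hs =>
    Measure.integrableOn_of_bounded (M := 1) hs hanti.measurable.aestronglyMeasurable
      (Eventually.of_forall fun t => by
        simp [abs_of_nonneg measureReal_nonneg])
  have hanti' : Antitone fun t : ℝ => ν.real (Metric.thickening ε {a | t ≤ f a}) := fun s t hst =>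
    measureReal_mono (Metric.thickening_subset_of_subset ε fun a (ha : t ≤ f a) => hst.trans ha)
  have hbd' : IntegrableOn (fun t : ℝ => ν.real (Metric.thickening ε {a | t ≤ f a}))
      (Set.Ioc 0 ‖f‖) :=
    Measure.integrableOn_of_bounded (M := 1) measure_Ioc_lt_top.ne
      hanti'.measurable.aestronglyMeasurable
      (Eventually.of_forall fun t => by
        simp [abs_of_nonneg measureReal_nonneg])
  -- By the Lipschitz bound, the `ε`-thickening of a superlevel set of `f` lies in the same
  -- superlevel set of `f + ε`. The shift contributes `ε` and the Lévy–Prokhorov estimate `ε * ‖f‖`.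
  have h3 : ∫ t in Set.Ioc 0 ‖f‖, ν.real (Metric.thickening ε {a | t ≤ f a}) ≤
      ∫ t in Set.Ioc 0 ‖f‖, ν.real {a | t ≤ f a + ε} := by
    refine integral_mono hbd' (hbd _ measure_Ioc_lt_top.ne) fun t => measureReal_mono fun x hx => ?_
    obtain ⟨y, hy, hxy⟩ := Metric.mem_thickening_iff.1 hx
    have h4 := (abs_le.1 (hlip x y)).1
    have hy' : t ≤ f y := hy
    change t ≤ f x + ε
    linarith
  have h4 : ∫ t in Set.Ioc 0 ‖f‖, ν.real {a | t ≤ f a + ε} ≤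
      ∫ t in Set.Ioc 0 (‖f‖ + ε), ν.real {a | t ≤ f a + ε} :=
    setIntegral_mono_set (hbd _ measure_Ioc_lt_top.ne)
      (Eventually.of_forall fun t => measureReal_nonneg)
      (Set.Ioc_subset_Ioc_right (by linarith)).eventuallyLE
  rw [integral_add (f.integrable ν) (integrable_const ε)] at h2
  simp only [integral_const, probReal_univ, one_smul] at h2
  linarith

/-- Equicontinuity says that `w ↦ (G i w)_i` is continuous into bounded functions on `I` with the
sup norm. Pulling the product metric back along its graph keeps the topology of `W` and makes every
`G i` 1-Lipschitz. The Lévy–Prokhorov distance for this metric then controls all the integrals at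
once. -/
lemma eventually_forall_abs_integral_sub_le {W I ι : Type*} [TopologicalSpace W]
    [PseudoMetrizableSpace W] [SecondCountableTopology W] [MeasurableSpace W]
    [OpensMeasurableSpace W] {l : Filter ι} {μs : ι → ProbabilityMeasure W}
    {μ : ProbabilityMeasure W} (hμ : Tendsto μs l (𝓝 μ)) (G : I → W → ℝ) {M : ℝ}
    (hM : ∀ i w, |G i w| ≤ M)
    (hG : ∀ w, ∀ ε > 0, ∀ᶠ w' in 𝓝 w, ∀ i, |G i w' - G i w| ≤ ε) {ε : ℝ} (hε : 0 < ε) :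
    ∀ᶠ n in l, ∀ i, |∫ w, G i w ∂(μs n : Measure W) - ∫ w, G i w ∂(μ : Measure W)| ≤ ε := by
  rcases isEmpty_or_nonempty I with hI | ⟨⟨i₀⟩⟩
  · exact Eventually.of_forall fun n i => hI.elim i
  let _ : TopologicalSpace I := ⊥
  have : DiscreteTopology I := ⟨rfl⟩
  let _ : PseudoMetricSpace W := pseudoMetrizableSpacePseudoMetric W
  let Γ : W → (I →ᵇ ℝ) := fun w =>
    BoundedContinuousFunction.ofNormedAddCommGroupDiscrete (fun i => G i w) M fun i => hM i w
  have hΓ : Continuous Γ := continuous_iff_continuousAt.2 fun w =>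
      Metric.tendsto_nhds.2 fun δ hδ => by
    filter_upwards [hG w (δ / 2) (half_pos hδ)] with w' hw'
    exact ((BoundedContinuousFunction.dist_le (half_pos hδ).le).2 hw').trans_lt (half_lt_self hδ)
  have hΓ' := (isEmbedding_graph hΓ).isInducing
  let _ : PseudoMetricSpace W := hΓ'.comapPseudoMetricSpace
  have hdist : ∀ i w w', |G i w - G i w'| ≤ dist w w' := fun i w w' =>
    ((Γ w).dist_coe_le_dist (g := Γ w') i).trans (le_max_right _ _)
  obtain ⟨w₀⟩ : Nonempty W := μ.nonempty
  have hM0 : 0 ≤ M := (abs_nonneg _).trans (hM i₀ w₀)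
  have hcont : ∀ i, Continuous (G i) := fun i =>
    (LipschitzWith.of_dist_le_mul (K := 1) fun w w' => by
      simpa [Real.dist_eq] using hdist i w w').continuous
  -- The shift by `M` gives the nonnegativity needed by the layer-cake estimate; it cancels in the
  -- difference of integrals.
  let f : I → (W →ᵇ ℝ) := fun i => BoundedContinuousFunction.ofNormedAddCommGroup
    (fun w => G i w + M) ((hcont i).add continuous_const) (2 * M) fun w => by
      have := abs_le.1 (hM i w)
      rw [Real.norm_eq_abs, abs_le]; constructor <;> linarith
  have hfn : ∀ i, ‖f i‖ ≤ 2 * M := fun i =>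
    BoundedContinuousFunction.norm_ofNormedAddCommGroup_le _ (by positivity) _
  have hf0 : ∀ i w, 0 ≤ f i w := fun i w => by
    have := (abs_le.1 (hM i w)).1
    change 0 ≤ G i w + M
    linarith
  have hfl : ∀ i w w', |f i w - f i w'| ≤ dist w w' := fun i w w' => by
    change |G i w + M - (G i w' + M)| ≤ _
    simpa using hdist i w w'
  have hfint : ∀ i (ν : ProbabilityMeasure W),
      ∫ w, f i w ∂(ν : Measure W) = ∫ w, G i w ∂(ν : Measure W) + M := fun i ν => by
    have h : Integrable (G i) (ν : Measure W) :=
      .of_bound (hcont i).aestronglyMeasurable M (Eventually.of_forall (hM i))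
    change ∫ w, (G i w + M) ∂(ν : Measure W) = _
    rw [integral_add h (integrable_const M)]
    simp
  set δ : ℝ := ε / (1 + 2 * M) with hδ
  have hδ0 : 0 < δ := by positivity
  have hδε : δ * (1 + 2 * M) = ε := by rw [hδ]; field_simp
  have hlp := (LevyProkhorov.continuous_ofMeasure_probabilityMeasure (Ω := W)).tendsto μ |>.comp hμ
  have hlp' := EMetric.tendsto_nhds.1 hlp (ENNReal.ofReal δ) (by simpa using hδ0)
  filter_upwards [hlp'] with n hn i
  have hle : δ * (1 + ‖f i‖) ≤ ε := by
    rw [← hδε]; have := hfn i; gcongr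
  have h1 := integral_le_add_of_levyProkhorovEDist_lt (μs n : Measure W) (μ : Measure W) hδ0 hn
    (f i) (hf0 i) (hfl i)
  have h2 := integral_le_add_of_levyProkhorovEDist_lt (μ : Measure W) (μs n : Measure W) hδ0
    (by rw [levyProkhorovEDist_comm]; exact hn) (f i) (hf0 i) (hfl i)
  rw [hfint, hfint] at h1 h2
  rw [abs_le]; constructor <;> linarith

/-! ### Convergence in total variation -/

/-- Layer cake for `g + M`, which takes values in `[0, 2M]`: superlevel sets differ in measure by at
most `δ`, over an interval of length `2M`. -/
lemma abs_integral_sub_le_of_forall_measureReal {Y : Type*} [MeasurableSpace Y] (μ ν : Measure Y)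
    [IsProbabilityMeasure μ] [IsProbabilityMeasure ν] {δ : ℝ}
    (h : ∀ C, MeasurableSet C → |μ.real C - ν.real C| ≤ δ) {g : Y → ℝ} (hg : Measurable g) {M : ℝ}
    (hM : ∀ y, |g y| ≤ M) : |∫ y, g y ∂μ - ∫ y, g y ∂ν| ≤ 2 * M * δ := by
  obtain ⟨y₀⟩ : Nonempty Y := nonempty_of_isProbabilityMeasure μ
  have hM0 : 0 ≤ M := (abs_nonneg _).trans (hM y₀)
  have key : ∀ (ρ : Measure Y) [IsProbabilityMeasure ρ], ∫ y, g y ∂ρ + M =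
      ∫ t in Set.Ioc 0 (2 * M), ρ.real {y | t ≤ g y + M} := fun ρ _ => by
    have hi : Integrable g ρ := .of_bound hg.aestronglyMeasurable M (Eventually.of_forall hM)
    have hi' : Integrable (fun y => g y + M) ρ := hi.add (integrable_const M)
    rw [← hi'.integral_eq_integral_Ioc_meas_le (M := 2 * M)]
    · rw [integral_add hi (integrable_const M)]
      simp
    · exact Eventually.of_forall fun y => by
        have := (abs_le.1 (hM y)).1; simp only [Pi.zero_apply]; linarith
    · exact Eventually.of_forall fun y => by
        have := (abs_le.1 (hM y)).2; simp only; linarith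
  have hint : ∀ (ρ : Measure Y) [IsProbabilityMeasure ρ],
      IntegrableOn (fun t => ρ.real {y | t ≤ g y + M}) (Set.Ioc 0 (2 * M)) := fun ρ _ => by
    have hanti : Antitone fun t : ℝ => ρ.real {y | t ≤ g y + M} := fun s t hst =>
      measureReal_mono fun a (ha : t ≤ g a + M) => hst.trans ha
    exact Measure.integrableOn_of_bounded (M := 1) measure_Ioc_lt_top.ne
      hanti.measurable.aestronglyMeasurable (Eventually.of_forall fun t => by
        simp [abs_of_nonneg measureReal_nonneg])
  have h1 : ∫ y, g y ∂μ - ∫ y, g y ∂ν =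
      ∫ t in Set.Ioc 0 (2 * M), (μ.real {y | t ≤ g y + M} - ν.real {y | t ≤ g y + M}) := by
    rw [integral_sub (hint μ) (hint ν), ← key μ, ← key ν]; ring
  rw [h1, ← Real.norm_eq_abs]
  refine (norm_setIntegral_le_of_norm_le_const (C := δ) measure_Ioc_lt_top
    fun t _ => h _ (measurableSet_le measurable_const (hg.add_const M))).trans_eq ?_
  rw [Real.volume_real_Ioc_of_le (by positivity)]
  ring

lemma abs_measureReal_sub_le_tvDist {Y : Type*} [MeasurableSpace Y] (μ ν : ProbabilityMeasure Y)
    {C : Set Y} (hC : MeasurableSet C) :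
    |(μ : Measure Y).real C - (ν : Measure Y).real C| ≤ tvDist μ ν := by
  have hbdd : BddAbove (Set.range fun C : {C : Set Y // MeasurableSet C} =>
      ((μ : Measure Y).real C.1 - (ν : Measure Y).real C.1)) := ⟨1, by
    rintro _ ⟨D, rfl⟩
    have h1 : (μ : Measure Y).real D.1 ≤ 1 := measureReal_le_one
    have h2 : 0 ≤ (ν : Measure Y).real D.1 := measureReal_nonneg
    simp only
    linarith⟩
  have h1 := le_ciSup hbdd ⟨C, hC⟩
  have h2 := le_ciSup hbdd ⟨Cᶜ, hC.compl⟩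
  -- The complement gives the opposite sign; the empty set makes the supremum nonnegative, so the
  -- factor 2 in `tvDist` does no harm.
  have h3 := le_ciSup hbdd ⟨∅, MeasurableSet.empty⟩
  simp only [measureReal_empty, probReal_compl_eq_one_sub hC, sub_self] at h1 h2 h3
  rw [tvDist, abs_le]
  constructor <;> linarith

/-- Uniform convergence of `∫_C h_n dμ_n` over measurable sets `C`, with `μ_n → μ` in total
variation, gives convergence of `h_n` in `L¹(μ)`. -/
lemma tendsto_lintegral_enorm_sub {Y ι : Type*} [MeasurableSpace Y] {l : Filter ι}
    {μs : ι → Measure Y} {μ : Measure Y} [∀ n, IsProbabilityMeasure (μs n)]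
    [IsProbabilityMeasure μ]
    (hμ : ∀ ε > 0, ∀ᶠ n in l, ∀ C, MeasurableSet C → |(μs n).real C - μ.real C| ≤ ε)
    {hs : ι → Y → ℝ} {h : Y → ℝ} (hsm : ∀ n, Measurable (hs n)) (hm : Measurable h) {M : ℝ}
    (hsM : ∀ n y, |hs n y| ≤ M) (hM : ∀ y, |h y| ≤ M)
    (hh : ∀ ε > 0, ∀ᶠ n in l, ∀ C, MeasurableSet C →
      |∫ y in C, hs n y ∂(μs n) - ∫ y in C, h y ∂μ| ≤ ε) :
    Tendsto (fun n => ∫⁻ y, ‖hs n y - h y‖ₑ ∂μ) l (𝓝 0) := by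
  obtain ⟨y₀⟩ : Nonempty Y := nonempty_of_isProbabilityMeasure μ
  have hM0 : 0 ≤ M := (abs_nonneg _).trans (hM y₀)
  have hsi : ∀ n, Integrable (hs n) μ := fun n =>
    .of_bound (hsm n).aestronglyMeasurable M (Eventually.of_forall (hsM n))
  have hi : Integrable h μ := .of_bound hm.aestronglyMeasurable M (Eventually.of_forall hM)
  suffices H : Tendsto (fun n => ∫ y, ‖hs n y - h y‖ ∂μ) l (𝓝 0) by
    rw [← ENNReal.ofReal_zero]
    exact (ENNReal.tendsto_ofReal H).congr fun n =>
      ofReal_integral_norm_eq_lintegral_enorm ((hsi n).sub hi)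
  refine Metric.tendsto_nhds.2 fun ε hε => ?_
  set δ : ℝ := ε / (4 * (1 + 2 * M)) with hδ
  have hδ0 : 0 < δ := by positivity
  have hδε : 2 * (2 * M * δ + δ) < ε := by
    have : 2 * (2 * M * δ + δ) = ε / 2 := by rw [hδ]; field_simp; ring
    linarith
  filter_upwards [hμ δ hδ0, hh δ hδ0] with n h1 h2
  -- Replacing `μ` by `μs n` in the integral of `hs n` costs `2 * M * δ`; the hypothesis on set
  -- integrals costs the other `δ`.
  have h3 : ∀ C, MeasurableSet C → |∫ y in C, (hs n y - h y) ∂μ| ≤ 2 * M * δ + δ := fun C hC => by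
    rw [integral_sub (hsi n).integrableOn hi.integrableOn]
    have h4 := abs_integral_sub_le_of_forall_measureReal (μs n) μ h1 ((hsm n).indicator hC)
      (M := M) fun y => by
        by_cases hy : y ∈ C
        · simpa [hy] using hsM n y
        · simpa [hy] using hM0
    rw [integral_indicator hC, integral_indicator hC] at h4
    have h5 := abs_le.1 h4
    have h6 := abs_le.1 (h2 C hC)
    rw [abs_le]; constructor <;> linarith [h5.1, h5.2, h6.1, h6.2]
  have hC : MeasurableSet {y | h y ≤ hs n y} := measurableSet_le hm (hsm n)
  have hint : Integrable (fun y => ‖hs n y - h y‖) μ := ((hsi n).sub hi).norm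
  -- The `L¹` norm is recovered from the two sets on which the difference has constant sign. They
  -- depend on `n`, hence the need for uniformity in `C`.
  have h4 : ∫ y, ‖hs n y - h y‖ ∂μ =
      ∫ y in {y | h y ≤ hs n y}, (hs n y - h y) ∂μ -
        ∫ y in {y | h y ≤ hs n y}ᶜ, (hs n y - h y) ∂μ := by
    rw [← integral_add_compl hC hint, sub_eq_add_neg, ← integral_neg]
    congr 1
    · exact setIntegral_congr_fun hC fun y (hy : h y ≤ hs n y) => abs_of_nonneg (sub_nonneg.2 hy)
    · exact setIntegral_congr_fun hC.compl fun y (hy : ¬ h y ≤ hs n y) =>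
        abs_of_nonpos (sub_nonpos.2 (not_le.1 hy).le)
  have h5 := abs_le.1 (h3 _ hC)
  have h6 := abs_le.1 (h3 _ hC.compl)
  rw [Real.dist_0_eq_abs, abs_of_nonneg (integral_nonneg fun y => norm_nonneg _), h4]
  linarith [h5.2, h6.1]

/-! ### Almost everywhere convergence along a subsequence -/

/-- Diagonal choice: at stage `m` the first `m + 1` integrals are at most `2⁻ᵐ`. For each `k` the
tail sum then has finite integral, so it is finite almost everywhere and its terms tend to 0. -/
lemma exists_strictMono_forall_ae_tendsto {Y : Type*} [MeasurableSpace Y] {μ : Measure Y}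
    {g : ℕ → ℕ → Y → ℝ≥0∞} (hg : ∀ k n, Measurable (g k n))
    (h : ∀ k, Tendsto (fun n => ∫⁻ y, g k n y ∂μ) atTop (𝓝 0)) :
    ∃ φ : ℕ → ℕ, StrictMono φ ∧
      ∀ᵐ y ∂μ, ∀ k, Tendsto (fun m => g k (φ m) y) atTop (𝓝 0) := by
  have hev : ∀ m : ℕ, ∀ᶠ n in atTop, ∀ k ∈ Finset.range (m + 1),
      ∫⁻ y, g k n y ∂μ ≤ (2⁻¹ : ℝ≥0∞) ^ m := fun m =>
    (Finset.eventually_all _).2 fun k _ =>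
      ENNReal.tendsto_nhds_zero.1 (h k) _ (ENNReal.pow_pos (by simp) m)
  obtain ⟨φ, hφ, hle⟩ := extraction_forall_of_eventually hev
  refine ⟨φ, hφ, ae_all_iff.2 fun k => ?_⟩
  -- The sum starts at index `k` because the bound for `g k` is available only from stage `k` on.
  have hfin : ∫⁻ y, ∑' m, g k (φ (m + k)) y ∂μ ≠ ∞ := by
    rw [lintegral_tsum fun m => (hg k _).aemeasurable]
    refine ne_top_of_le_ne_top ?_ (ENNReal.tsum_le_tsum fun m =>
      (hle (m + k) k (by simp)).trans
        (pow_le_pow_of_le_one (by simp) (by simp) (Nat.le_add_right m k)))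
    rw [ENNReal.tsum_geometric]
    simp
  filter_upwards [ae_lt_top (Measurable.tsum fun m => hg k _) hfin] with y hy
  exact (tendsto_add_atTop_iff_nat k).1 (ENNReal.tendsto_atTop_zero_of_tsum_ne_top hy.ne)

/-! ### A countable convergence determining class -/

/-- The test functions approximate from above the indicators of complements of finite unions of
basic open sets; there are countably many. They give the portmanteau inequality on those finite
unions. It passes to any open set, which is a directed union of them, by continuity of the limit
measure from below. -/
lemma exists_seq_convergence_determining (X : Type*) [TopologicalSpace X]
    [PseudoMetrizableSpace X] [SecondCountableTopology X] [MeasurableSpace X]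
    [OpensMeasurableSpace X] :
    ∃ f : ℕ → (X →ᵇ ℝ), ∀ (μs : ℕ → ProbabilityMeasure X) (μ : ProbabilityMeasure X),
      (∀ k, Tendsto (fun n => ∫ x, f k x ∂(μs n : Measure X)) atTop
        (𝓝 (∫ x, f k x ∂(μ : Measure X)))) → Tendsto μs atTop (𝓝 μ) := by
  let ι := Finset (countableBasis X) × ℕ
  have hopen : ∀ s : Finset (countableBasis X), IsOpen (⋃ u ∈ s, (u : Set X)) := fun s =>
    isOpen_biUnion fun u _ => isOpen_of_mem_countableBasis u.2
  let F : ι → (X →ᵇ ℝ≥0) := fun i => (hopen i.1).isClosed_compl.apprSeq i.2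
  obtain ⟨e, he⟩ := exists_surjective_nat ι
  refine ⟨fun k => BoundedContinuousFunction.ofNormedAddCommGroup (fun x => (F (e k) x : ℝ))
    (NNReal.continuous_coe.comp (F (e k)).continuous) 1 fun x => ?_, fun μs μ h => ?_⟩
  · rw [NNReal.norm_eq]
    exact_mod_cast
      HasOuterApproxClosed.apprSeq_apply_le_one (hopen (e k).1).isClosed_compl (e k).2 x
  have hF : ∀ i, Tendsto (fun n => ∫⁻ x, F i x ∂(μs n : Measure X)) atTop
      (𝓝 (∫⁻ x, F i x ∂(μ : Measure X))) := fun i => by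
    obtain ⟨k, rfl⟩ := he i
    have hk : ∀ ν : ProbabilityMeasure X, ∫⁻ x, F (e k) x ∂(ν : Measure X) =
        ENNReal.ofReal (∫ x, (F (e k) x : ℝ) ∂(ν : Measure X)) := fun ν => by
      rw [ofReal_integral_eq_lintegral_ofReal]
      · simp
      · exact (F (e k)).integrable_of_nnreal (ν : Measure X)
      · exact Eventually.of_forall fun x => NNReal.coe_nonneg _
    simp only [hk]
    exact ENNReal.tendsto_ofReal (h k)
  have hclosed : ∀ s : Finset (countableBasis X),
      limsup (fun n => (μs n : Measure X) (⋃ u ∈ s, (u : Set X))ᶜ) atTop ≤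
        (μ : Measure X) (⋃ u ∈ s, (u : Set X))ᶜ := fun s => by
    have hc := (hopen s).isClosed_compl
    refine ge_of_tendsto' (HasOuterApproxClosed.tendsto_lintegral_apprSeq hc (μ : Measure X))
      fun m => ?_
    rw [← (hF (s, m)).limsup_eq]
    exact limsup_le_limsup (Eventually.of_forall fun n =>
      HasOuterApproxClosed.measure_le_lintegral hc (μs n : Measure X) m)
  have hfin : ∀ s : Finset (countableBasis X), (μ : Measure X) (⋃ u ∈ s, (u : Set X)) ≤
      liminf (fun n => (μs n : Measure X) (⋃ u ∈ s, (u : Set X))) atTop := fun s =>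
    le_measure_liminf_of_limsup_measure_compl_le (hopen s).measurableSet (hclosed s)
  refine tendsto_of_forall_isOpen_le_liminf_nat' fun G hG => ?_
  let T := {s : Finset (countableBasis X) // ∀ u ∈ s, (u : Set X) ⊆ G}
  have hGT : G = ⋃ s : T, ⋃ u ∈ s.1, (u : Set X) := by
    refine Set.Subset.antisymm (fun x hx => ?_)
      (Set.iUnion_subset fun s => Set.iUnion₂_subset fun u hu => s.2 u hu)
    obtain ⟨u, hu, hxu, huG⟩ := (isBasis_countableBasis X).exists_subset_of_mem_open hx hG
    exact Set.mem_iUnion.2 ⟨⟨{⟨u, hu⟩}, by simpa using huG⟩, by simpa using hxu⟩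
  have hdir : Directed (· ⊆ ·) fun s : T => ⋃ u ∈ s.1, (u : Set X) := fun s t => by
    classical
    refine ⟨⟨s.1 ∪ t.1, fun u hu => (Finset.mem_union.1 hu).elim (s.2 u) (t.2 u)⟩, ?_, ?_⟩
    · exact Set.biUnion_subset_biUnion_left fun u hu => Finset.mem_union_left _ hu
    · exact Set.biUnion_subset_biUnion_left fun u hu => Finset.mem_union_right _ hu
  have hle : ∀ s : T, (⋃ u ∈ s.1, (u : Set X)) ⊆ G := fun s =>
    Set.iUnion₂_subset fun u hu => s.2 u hu
  calc (μ : Measure X) G = ⨆ s : T, (μ : Measure X) (⋃ u ∈ s.1, (u : Set X)) := by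
        conv_lhs => rw [hGT]
        exact hdir.measure_iUnion
    _ ≤ liminf (fun n => (μs n : Measure X) G) atTop := iSup_le fun s => (hfin s.1).trans
        (liminf_le_liminf (Eventually.of_forall fun n => measure_mono (hle s)))

section Kernels

variable {X Y A : Type*} [MeasurableSpace X] [MeasurableSpace Y] [MeasurableSpace A]

/-! ### The joint law of the next state and the next observation -/

lemma integral_nextStateKernel [TopologicalSpace X] [OpensMeasurableSpace X]
    (P : Kernel (X × A) X) [IsMarkovKernel P] (z : ProbabilityMeasure X) (a : A) (f : X →ᵇ ℝ) :
    ∫ x', f x' ∂(nextStateKernel P (z, a)) = ∫ x, ∫ x', f x' ∂(P (x, a)) ∂(z : Measure X) := by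
  rw [nextStateKernel, Kernel.snd_apply, integral_map (by fun_prop)
    f.continuous.aestronglyMeasurable, integral_compProd]
  · rfl
  · exact .of_bound (f.continuous.measurable.comp measurable_snd).aestronglyMeasurable ‖f‖
      (Eventually.of_forall fun r => f.norm_coe_le_norm _)

lemma jointKernel_prod_eq (P : Kernel (X × A) X) [IsMarkovKernel P] (Q : Kernel (A × X) Y)
    [IsMarkovKernel Q] (p : ProbabilityMeasure X × A) {B : Set X} (hB : MeasurableSet B)
    {C : Set Y} (hC : MeasurableSet C) :
    jointKernel P Q p (B ×ˢ C) = ∫⁻ x in B, Q (p.2, x) C ∂(nextStateKernel P p) := by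
  rw [jointKernel, Kernel.compProd_apply_prod hB hC]
  rfl

lemma obsKernel_real_eq_integral (P : Kernel (X × A) X) [IsMarkovKernel P]
    (Q : Kernel (A × X) Y) [IsMarkovKernel Q] (p : ProbabilityMeasure X × A) {C : Set Y}
    (hC : MeasurableSet C) :
    (obsKernel P Q p).real C = ∫ x, (Q (p.2, x)).real C ∂(nextStateKernel P p) := by
  have hm : Measurable fun x => Q (p.2, x) C :=
    (Q.measurable_coe hC).comp (measurable_const.prodMk measurable_id)
  have h : obsKernel P Q p C = ∫⁻ x, Q (p.2, x) C ∂(nextStateKernel P p) := by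
    rw [obsKernel, Kernel.snd_apply' _ _ hC, ← setLIntegral_univ,
      ← jointKernel_prod_eq P Q p MeasurableSet.univ hC, Set.univ_prod]
  rw [measureReal_def, h]
  exact (integral_toReal hm.aemeasurable (Eventually.of_forall fun x => measure_lt_top _ _)).symm

/-- Integrated form of the defining equation of a filtering kernel. -/
lemma IsFilteringKernel.setIntegral_eq [TopologicalSpace X] [OpensMeasurableSpace X]
    {P : Kernel (X × A) X} [IsMarkovKernel P]
    {Q : Kernel (A × X) Y} [IsMarkovKernel Q] {H : Kernel (ProbabilityMeasure X × A × Y) X}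
    [IsMarkovKernel H] (hH : IsFilteringKernel P Q H) (p : ProbabilityMeasure X × A)
    (f : X →ᵇ ℝ) {C : Set Y} (hC : MeasurableSet C) :
    ∫ y in C, ∫ x, f x ∂(H (p.1, p.2, y)) ∂(obsKernel P Q p) =
      ∫ x, f x * (Q (p.2, x)).real C ∂(nextStateKernel P p) := by
  have hm : Measurable fun x => Q (p.2, x) C :=
    (Q.measurable_coe hC).comp (measurable_const.prodMk measurable_id)
  let η : Kernel Y X := H.comap (fun y => (p.1, p.2, y)) (by fun_prop)
  -- Both sides are the measure `B ↦ R(B × C|z,a)` on states, so integrating `f` against it in two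
  -- ways gives the claim.
  have heq : (((obsKernel P Q p).restrict C) ⊗ₘ η).snd =
      (nextStateKernel P p).withDensity fun x => Q (p.2, x) C := by
    ext B hB
    rw [withDensity_apply _ hB, ← jointKernel_prod_eq P Q p hB hC, hH p.1 p.2 B C hB hC,
      Measure.snd_apply hB, ← Set.univ_prod, Measure.compProd_apply_prod MeasurableSet.univ hB,
      Measure.restrict_univ]
    rfl
  have h1 : ∫ x, f x ∂(((obsKernel P Q p).restrict C) ⊗ₘ η).snd =
      ∫ y in C, ∫ x, f x ∂(H (p.1, p.2, y)) ∂(obsKernel P Q p) := by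
    rw [Measure.snd, integral_map (by fun_prop) f.continuous.aestronglyMeasurable,
      Measure.integral_compProd]
    · rfl
    · exact .of_bound (f.continuous.measurable.comp measurable_snd).aestronglyMeasurable ‖f‖
        (Eventually.of_forall fun r => f.norm_coe_le_norm _)
  rw [← h1, heq, integral_withDensity_eq_integral_toReal_smul hm
    (Eventually.of_forall fun x => measure_lt_top _ _)]
  simp only [smul_eq_mul, measureReal_def, mul_comm]

/-- Conditioning the joint law on the observation gives a filtering kernel. -/
lemma exists_isFilteringKernel [StandardBorelSpace X] [MeasurableSpace.CountablyGenerated Y]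
    (P : Kernel (X × A) X) [IsMarkovKernel P] (Q : Kernel (A × X) Y) [IsMarkovKernel Q] :
    ∃ (H : Kernel (ProbabilityMeasure X × A × Y) X) (_ : IsMarkovKernel H),
      IsFilteringKernel P Q H := by
  rcases isEmpty_or_nonempty X with hX | hX
  -- With no states there are no beliefs, so the zero kernel qualifies vacuously.
  · have hE : IsEmpty (ProbabilityMeasure X) := ⟨fun z => hX.elim z.nonempty.some⟩
    exact ⟨0, ⟨fun r => hE.elim r.1⟩, fun z => hE.elim z⟩
  -- `condKernel` conditions on the first coordinate, so the observation is moved there.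
  · let J : Kernel (ProbabilityMeasure X × A) (Y × X) := (jointKernel P Q).swapRight
    refine ⟨J.condKernel.comap (fun r : ProbabilityMeasure X × A × Y => ((r.1, r.2.1), r.2.2))
      (by fun_prop), inferInstance, fun z a B C hB hC => ?_⟩
    have h1 : jointKernel P Q (z, a) (B ×ˢ C) = J (z, a) (C ×ˢ B) := by
      rw [Kernel.swapRight_apply' _ _ (hC.prod hB)]
      congr 1
      ext ⟨x, y⟩
      simp [and_comm]
    have h2 : J.fst = obsKernel P Q := by rw [Kernel.fst_swapRight]; rfl
    rw [h1, ← h2]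
    conv_lhs => rw [← Kernel.disintegrate J J.condKernel]
    rw [Kernel.compProd_apply_prod hC hB]
    rfl

end Kernels

/-! ### Weak continuity of the law of the next state -/

lemma WeaklyContinuous.continuous_law {S T : Type*} [TopologicalSpace S] [SequentialSpace S]
    [MeasurableSpace S] [TopologicalSpace T] [MeasurableSpace T] [OpensMeasurableSpace T]
    {κ : Kernel S T} [IsMarkovKernel κ] (h : WeaklyContinuous κ) : Continuous (law κ) :=
  SeqContinuous.continuous fun _ _ hu => h _ _ hu

section Model

variable {X Y A : Type*}
  [TopologicalSpace X] [MetrizableSpace X] [SecondCountableTopology X]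
  [MeasurableSpace X] [BorelSpace X]
  [MeasurableSpace Y]
  [TopologicalSpace A] [MetrizableSpace A] [SecondCountableTopology A]
  [MeasurableSpace A] [BorelSpace A]

/-- The integral of `f` against the next-state law is the integral of `ψ(x, a) = ∫ f dP(·|x,a)`
against `z ⊗ δ_a`. Here `ψ` is bounded and continuous by weak continuity of `P`, and `z ⊗ δ_a`
depends weakly continuously on `(z, a)`. -/
lemma continuous_law_nextStateKernel {P : Kernel (X × A) X} [IsMarkovKernel P]
    (hP : WeaklyContinuous P) : Continuous (law (nextStateKernel P)) := by
  have hPc := hP.continuous_law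
  refine continuous_iff_continuousAt.2 fun p =>
    ProbabilityMeasure.tendsto_iff_forall_integral_tendsto.2 fun f => ?_
  let ψ : X × A →ᵇ ℝ := BoundedContinuousFunction.ofNormedAddCommGroup
    (fun r => ∫ x', f x' ∂(P r))
    ((ProbabilityMeasure.continuous_integral_boundedContinuousFunction f).comp hPc) ‖f‖
    fun r => (norm_integral_le_of_norm_le_const
      (Eventually.of_forall fun x => f.norm_coe_le_norm x)).trans_eq (by simp)
  have hψ : ∀ q : ProbabilityMeasure X × A, ∫ x', f x' ∂(law (nextStateKernel P) q : Measure X) =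
      ∫ r, ψ r ∂(q.1.prod (diracProba q.2) : Measure (X × A)) := fun q => by
    rw [ProbabilityMeasure.toMeasure_prod, integral_prod _ (ψ.integrable _)]
    refine (integral_nextStateKernel P q.1 q.2 f).trans
      (integral_congr_ae (Eventually.of_forall fun x => ?_))
    exact (integral_dirac (fun a => ψ (x, a)) q.2).symm
  simp only [hψ]
  have hc : Continuous fun q : ProbabilityMeasure X × A => q.1.prod (diracProba q.2) :=
    ProbabilityMeasure.continuous_prod.comp
      (continuous_fst.prodMk (continuous_diracProba.comp continuous_snd))
  exact ((ProbabilityMeasure.continuous_integral_boundedContinuousFunction ψ).comp hc).tendsto p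

/-! ### Uniform convergence over sets of observations -/

lemma eventually_forall_abs_integral_mul_sub_le {P : Kernel (X × A) X} [IsMarkovKernel P]
    {Q : Kernel (A × X) Y} [IsMarkovKernel Q] (hP : WeaklyContinuous P) (hQ : TVContinuous Q)
    {ps : ℕ → ProbabilityMeasure X × A} {p : ProbabilityMeasure X × A}
    (hp : Tendsto ps atTop (𝓝 p)) (f : X →ᵇ ℝ) {ε : ℝ} (hε : 0 < ε) :
    ∀ᶠ n in atTop, ∀ C, MeasurableSet C →
      |∫ x, f x * (Q ((ps n).2, x)).real C ∂(nextStateKernel P (ps n)) -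
        ∫ x, f x * (Q (p.2, x)).real C ∂(nextStateKernel P p)| ≤ ε := by
  have hprod : Tendsto (fun n => (diracProba (ps n).2).prod (law (nextStateKernel P) (ps n)))
      atTop (𝓝 ((diracProba p.2).prod (law (nextStateKernel P) p))) := by
    have hc : Continuous fun q : ProbabilityMeasure X × A =>
        (diracProba q.2).prod (law (nextStateKernel P) q) :=
      ProbabilityMeasure.continuous_prod.comp
        ((continuous_diracProba.comp continuous_snd).prodMk (continuous_law_nextStateKernel hP))
    exact (hc.tendsto p).comp hp
  let G : {C : Set Y // MeasurableSet C} → A × X → ℝ := fun C w => f w.2 * (Q w).real C.1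
  have hGm : ∀ C, Measurable (G C) := fun C =>
    (f.continuous.measurable.comp measurable_snd).mul (Q.measurable_coe C.2).ennreal_toReal
  have hGb : ∀ C w, |G C w| ≤ ‖f‖ := fun C w => by
    rw [abs_mul, abs_of_nonneg (measureReal_nonneg (μ := Q w))]
    exact (mul_le_of_le_one_right (abs_nonneg _) measureReal_le_one).trans (f.norm_coe_le_norm w.2)
  -- Equicontinuity over all `C`: the oscillation is at most `|f x' - f x| + ‖f‖ * tvDist`, a bound
  -- free of `C`. Setwise continuity of `Q` would not give this.
  have hGe : ∀ w, ∀ ε > 0, ∀ᶠ w' in 𝓝 w, ∀ C, |G C w' - G C w| ≤ ε := fun w ε hε => by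
    have htv : Tendsto (fun w' => tvDist (law Q w') (law Q w)) (𝓝 w) (𝓝 0) :=
      tendsto_of_seq_tendsto fun u hu => hQ u w hu
    have hfc : Tendsto (fun w' : A × X => |f w'.2 - f w.2|) (𝓝 w) (𝓝 0) := by
      have hc : Continuous fun w' : A × X => |f w'.2 - f w.2| := by fun_prop
      simpa using hc.tendsto w
    have hsum := hfc.add (htv.const_mul ‖f‖)
    rw [mul_zero, add_zero] at hsum
    filter_upwards [hsum.eventually_le_const hε] with w' hw' C
    refine le_trans ?_ hw'
    have h1 : G C w' - G C w = (f w'.2 - f w.2) * (Q w').real C.1 +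
        f w.2 * ((Q w').real C.1 - (Q w).real C.1) := by simp only [G]; ring
    rw [h1]
    refine (abs_add_le _ _).trans (add_le_add ?_ ?_)
    · rw [abs_mul, abs_of_nonneg (measureReal_nonneg (μ := Q w'))]
      exact mul_le_of_le_one_right (abs_nonneg _) measureReal_le_one
    · rw [abs_mul]
      exact mul_le_mul (f.norm_coe_le_norm _)
        (abs_measureReal_sub_le_tvDist (law Q w') (law Q w) C.2) (abs_nonneg _) (norm_nonneg _)
  have hGi : ∀ C (q : ProbabilityMeasure X × A),
      ∫ w, G C w ∂((diracProba q.2).prod (law (nextStateKernel P) q) : Measure (A × X)) =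
        ∫ x, f x * (Q (q.2, x)).real C.1 ∂(nextStateKernel P q) := fun C q => by
    rw [ProbabilityMeasure.toMeasure_prod, integral_prod _
      (.of_bound (hGm C).aestronglyMeasurable ‖f‖ (Eventually.of_forall (hGb C)))]
    exact integral_dirac (fun a => ∫ x, G C (a, x) ∂(nextStateKernel P q)) q.2
  filter_upwards [eventually_forall_abs_integral_sub_le hprod G hGb hGe hε] with n hn C hC
  simpa only [hGi] using hn ⟨C, hC⟩

/-- This is more than setwise continuity: uniformity in `C` allows `R'(·|zₙ,aₙ)` to be exchanged for
its limit under integrands that vary with `n`. -/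
lemma eventually_forall_abs_obsKernel_sub_le {P : Kernel (X × A) X} [IsMarkovKernel P]
    {Q : Kernel (A × X) Y} [IsMarkovKernel Q] (hP : WeaklyContinuous P) (hQ : TVContinuous Q)
    {ps : ℕ → ProbabilityMeasure X × A} {p : ProbabilityMeasure X × A}
    (hp : Tendsto ps atTop (𝓝 p)) {ε : ℝ} (hε : 0 < ε) :
    ∀ᶠ n in atTop, ∀ C, MeasurableSet C →
      |(obsKernel P Q (ps n)).real C - (obsKernel P Q p).real C| ≤ ε := by
  filter_upwards [eventually_forall_abs_integral_mul_sub_le hP hQ hp 1 hε] with n hn C hC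
  simpa [obsKernel_real_eq_integral P Q _ hC] using hn C hC

lemma setwiseContinuous_obsKernel {P : Kernel (X × A) X} [IsMarkovKernel P]
    {Q : Kernel (A × X) Y} [IsMarkovKernel Q] (hP : WeaklyContinuous P) (hQ : TVContinuous Q) :
    SetwiseContinuous (obsKernel P Q) := fun u s hu C hC => by
  refine (ENNReal.tendsto_toReal_iff (fun n => measure_ne_top _ _) (measure_ne_top _ _)).1 ?_
  refine Metric.tendsto_nhds.2 fun ε hε => ?_
  filter_upwards [eventually_forall_abs_obsKernel_sub_le hP hQ hu (half_pos hε)] with n hn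
  exact (hn C hC).trans_lt (half_lt_self hε)

/-! ### Convergence of the filter along a subsequence -/

lemma IsFilteringKernel.exists_subseq_ae_tendsto {P : Kernel (X × A) X} [IsMarkovKernel P]
    {Q : Kernel (A × X) Y} [IsMarkovKernel Q] (hP : WeaklyContinuous P) (hQ : TVContinuous Q)
    {H : Kernel (ProbabilityMeasure X × A × Y) X} [IsMarkovKernel H]
    (hH : IsFilteringKernel P Q H) {ps : ℕ → ProbabilityMeasure X × A}
    {p : ProbabilityMeasure X × A} (hp : Tendsto ps atTop (𝓝 p)) :
    ∃ φ : ℕ → ℕ, StrictMono φ ∧ ∀ᵐ y ∂(obsKernel P Q p),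
      Tendsto (fun k => law H ((ps (φ k)).1, (ps (φ k)).2, y)) atTop (𝓝 (law H (p.1, p.2, y))) := by
  obtain ⟨f, hf⟩ := exists_seq_convergence_determining X
  let h : ℕ → ProbabilityMeasure X × A → Y → ℝ := fun k q y => ∫ x, f k x ∂(H (q.1, q.2, y))
  have hm : ∀ k q, Measurable (h k q) := fun k q =>
    ((f k).continuous.stronglyMeasurable.integral_kernel (κ := H)).measurable.comp
      (measurable_const.prodMk (measurable_const.prodMk measurable_id))
  have hb : ∀ k q y, |h k q y| ≤ ‖f k‖ := fun k q y =>
    (norm_integral_le_of_norm_le_const (Eventually.of_forall fun x =>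
      (f k).norm_coe_le_norm x)).trans_eq (by simp)
  have hL1 : ∀ k, Tendsto (fun n => ∫⁻ y, ‖h k (ps n) y - h k p y‖ₑ ∂(obsKernel P Q p)) atTop
      (𝓝 0) := fun k => by
    refine tendsto_lintegral_enorm_sub (μs := fun n => obsKernel P Q (ps n))
      (fun ε hε => eventually_forall_abs_obsKernel_sub_le hP hQ hp hε) (fun n => hm k _) (hm k p)
      (fun n => hb k _) (hb k p) fun ε hε => ?_
    filter_upwards [eventually_forall_abs_integral_mul_sub_le hP hQ hp (f k) hε] with n hn C hC
    simpa only [h, hH.setIntegral_eq _ (f k) hC] using hn C hC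
  obtain ⟨φ, hφ, hae⟩ := exists_strictMono_forall_ae_tendsto
    (fun k n => ((hm k (ps n)).sub (hm k p)).enorm) hL1
  refine ⟨φ, hφ, ?_⟩
  filter_upwards [hae] with y hy
  refine hf _ _ fun k => ?_
  exact tendsto_iff_edist_tendsto_0.2 (by
    simp only [edist_eq_enorm_sub]; exact hy k)

/-! ### Weak continuity of the belief transition probability -/

lemma IsFilteringKernel.weaklyContinuous_beliefKernel {P : Kernel (X × A) X} [IsMarkovKernel P]
    {Q : Kernel (A × X) Y} [IsMarkovKernel Q] (hP : WeaklyContinuous P) (hQ : TVContinuous Q)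
    {H : Kernel (ProbabilityMeasure X × A × Y) X} [IsMarkovKernel H]
    (hH : IsFilteringKernel P Q H) : WeaklyContinuous (beliefKernel P Q H) := fun u p hu => by
  -- Almost sure convergence of the filters is available only along subsequences, which suffices for
  -- convergence of the whole sequence.
  refine tendsto_of_subseq_tendsto fun ns hns => ?_
  have hps : Tendsto (fun n => u (ns n)) atTop (𝓝 p) := hu.comp hns
  obtain ⟨φ, hφ, hae⟩ := hH.exists_subseq_ae_tendsto hP hQ hps
  refine ⟨φ, ProbabilityMeasure.tendsto_iff_forall_integral_tendsto.2 fun F => ?_⟩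
  have hlaw : ∀ q : ProbabilityMeasure X × A, Measurable fun y => law H (q.1, q.2, y) := fun q =>
    (measurable_law H).comp (by fun_prop)
  have hFm : ∀ q : ProbabilityMeasure X × A, Measurable fun y => F (law H (q.1, q.2, y)) :=
    fun q => F.continuous.measurable.comp (hlaw q)
  have hmap : ∀ q, beliefKernel P Q H q = (obsKernel P Q q).map fun y => law H (q.1, q.2, y) :=
    fun q => by
      ext D hD
      rw [show q = (q.1, q.2) from rfl, beliefKernel_apply P Q H _ _ hD,
        Measure.map_apply (hlaw q) hD, ← lintegral_indicator_one (hlaw q hD)]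
      rfl
  have hint : ∀ q, ∫ μ, F μ ∂(law (beliefKernel P Q H) q : Measure (ProbabilityMeasure X)) =
      ∫ y, F (law H (q.1, q.2, y)) ∂(obsKernel P Q q) := fun q => by
    change ∫ μ, F μ ∂(beliefKernel P Q H q) = _
    rw [hmap q, integral_map (hlaw q).aemeasurable F.continuous.aestronglyMeasurable]
  simp only [hint]
  set v : ℕ → ProbabilityMeasure X × A := fun n => u (ns (φ n)) with hv
  have hvp : Tendsto v atTop (𝓝 p) := hps.comp hφ.tendsto_atTop
  have h1 : Tendsto (fun n => ∫ y, F (law H ((v n).1, (v n).2, y)) ∂(obsKernel P Q p)) atTop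
      (𝓝 (∫ y, F (law H (p.1, p.2, y)) ∂(obsKernel P Q p))) := by
    refine tendsto_integral_of_dominated_convergence (fun _ => ‖F‖)
      (fun n => (hFm (v n)).aestronglyMeasurable) (integrable_const _)
      (fun n => Eventually.of_forall fun y => F.norm_coe_le_norm _) ?_
    filter_upwards [hae] with y hy
    exact (F.continuous.tendsto _).comp hy
  -- The integrand changes with `n`, but only its bound `‖F‖` enters the total variation estimate.
  have h2 : Tendsto (fun n => ∫ y, F (law H ((v n).1, (v n).2, y)) ∂(obsKernel P Q (v n)) -
      ∫ y, F (law H ((v n).1, (v n).2, y)) ∂(obsKernel P Q p)) atTop (𝓝 0) := by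
    refine Metric.tendsto_nhds.2 fun ε hε => ?_
    set δ : ℝ := ε / (2 * (1 + 2 * ‖F‖)) with hδ
    have hδ0 : 0 < δ := by positivity
    have hδε : 2 * ‖F‖ * δ < ε := by
      have h3 : (1 + 2 * ‖F‖) * δ = ε / 2 := by rw [hδ]; field_simp
      linarith
    filter_upwards [eventually_forall_abs_obsKernel_sub_le hP hQ hvp hδ0] with n hn
    rw [Real.dist_0_eq_abs]
    exact (abs_integral_sub_le_of_forall_measureReal _ _ hn (hFm (v n))
      fun y => F.norm_coe_le_norm _).trans_lt hδε
  simpa using h2.add h1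

end Model

end POMDP

theorem mainTheorem10 {X Y A : Type*}
    [TopologicalSpace X] [MetrizableSpace X] [SecondCountableTopology X]
    [MeasurableSpace X] [BorelSpace X] [StandardBorelSpace X]
    [TopologicalSpace Y] [MetrizableSpace Y] [SecondCountableTopology Y]
    [MeasurableSpace Y] [BorelSpace Y] [StandardBorelSpace Y]
    [TopologicalSpace A] [MetrizableSpace A] [SecondCountableTopology A]
    [MeasurableSpace A] [BorelSpace A] [StandardBorelSpace A]
    (P : Kernel (X × A) X) [IsMarkovKernel P] (Q : Kernel (A × X) Y) [IsMarkovKernel Q]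
    (hP : POMDP.WeaklyContinuous P) (hQ : POMDP.TVContinuous Q) :
    POMDP.SetwiseContinuous (POMDP.obsKernel P Q) ∧
      POMDP.AssumptionH P Q ∧
      ∀ (H : Kernel (ProbabilityMeasure X × A × Y) X) [IsMarkovKernel H],
        POMDP.IsFilteringKernel P Q H →
          POMDP.WeaklyContinuous (POMDP.beliefKernel P Q H) := by
  refine ⟨POMDP.setwiseContinuous_obsKernel hP hQ, ?_,
    fun H _ hH => hH.weaklyContinuous_beliefKernel hP hQ⟩
  obtain ⟨H, hHm, hH⟩ := POMDP.exists_isFilteringKernel P Q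
  exact ⟨H, hHm, hH, fun zs z as a hz ha =>
    hH.exists_subseq_ae_tendsto hP hQ (ps := fun n => (zs n, as n)) (hz.prodMk_nhds ha)⟩
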